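/- **Theorem 3.1 (= Theorem 1.3).** Let $n\ge 1$, let $p>n$ and $A>0$ be real numbers, and let $f:(0,\infty)\to(0,\infty)$ be continuous and nondecreasing with $$f(t)\ \ge\ A\,t^{p}\qquad\text{for all } t>0 .$$ Then the Monge–Ampère equation $\det D^2u=f(u)$ has no positive convex entire solution on $\mathbb R^n$; that is, there is no convex function $u:\mathbb R^n\to(0,\infty)$ that is twice differentiable at every point of $\mathbb R^n$ (in particular, none of class $C^2$) and satisfies $$\det D^2u(x)=f(u(x))\qquad\text{for all } x\in\mathbb R^n .$$ -/

import Mathlib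

noncomputable section

/-- The Hessian matrix `D²u(x)` of a real function on `ℝⁿ`: its `(i, j)` entry is the second
derivative of `u` at `x` in the coordinate directions `eᵢ`, `eⱼ`. -/
def hessian {n : ℕ} (u : EuclideanSpace ℝ (Fin n) → ℝ) (x : EuclideanSpace ℝ (Fin n)) :
    Matrix (Fin n) (Fin n) ℝ :=
  Matrix.of fun i j =>
    fderiv ℝ (fderiv ℝ u) x (EuclideanSpace.single i 1) (EuclideanSpace.single j 1)

/-- `u` is an entire solution of the Monge–Ampère equation `det D²u = f(u)`: it is twice
(Fréchet) differentiable on all of `ℝⁿ`, which every `C²` function is, and the equation holds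
at every point. -/
structure IsEntireSolution {n : ℕ} (f : ℝ → ℝ) (u : EuclideanSpace ℝ (Fin n) → ℝ) : Prop where
  differentiable : Differentiable ℝ u
  differentiable_fderiv : Differentiable ℝ (fderiv ℝ u)
  det_hessian : ∀ x, (hessian u x).det = f (u x)

end

open Filter Topology Set

/-! Compare `u` with the barrier `k * (1 - e‖y‖²)^(-N)`, which blows up on the sphere of radius
`e^(-1/2)`. For a suitable `k ≥ u 0` it touches `u` from above at some `x` in the ball
(`exists_touching_barrier`). With `s = 1 - e‖x‖²`, the barrier's second derivatives at `x` are at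
most `k C e s^(-N-2)`, where `C` depends only on `N` (`fderiv_fderiv_le_of_barrier`). They dominate
those of the convex `u`, so `A k^p s^(-Np) ≤ det D²u(x) ≤ (k C e)^n s^(-(N+2)n)`. As `p > n`, a
large `N` gives `Np ≥ (N+2)n`; since `s ≤ 1` the powers of `s` drop out, leaving `A (u 0)^(p-n) ≤ A
k^(p-n) ≤ (C e)^n`. The solution is entire, so `e → 0` is allowed and contradicts `u 0 > 0`. -/

/-- The second-order necessary condition for a local minimum on the line. -/
theorem nonneg_of_isLocalMin_of_hasDerivAt {φ φ' : ℝ → ℝ} {m : ℝ}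
    (hφ : ∀ᶠ t in 𝓝 0, HasDerivAt φ (φ' t) t) (hφ' : HasDerivAt φ' m 0)
    (hmin : IsLocalMin φ 0) : 0 ≤ m := by
  by_contra! hm
  -- The correction leaves second derivative `m / 2 < 0`, so `ψ` also has a local maximum at 0. Then
  -- `φ t - (m / 4) t² ≤ φ 0 ≤ φ t` near 0, impossible for `t ≠ 0` because `m < 0`.
  set ψ : ℝ → ℝ := fun t => φ t - m / 4 * t ^ 2 with hψ
  have h1 : ∀ᶠ t in 𝓝 0, HasDerivAt ψ (φ' t - m / 2 * t) t := by
    filter_upwards [hφ] with t ht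
    refine (ht.sub ((hasDerivAt_pow 2 t).const_mul (m / 4))).congr_deriv ?_
    push_cast
    ring
  have h2 : deriv ψ =ᶠ[𝓝 0] fun t => φ' t - m / 2 * t := by
    filter_upwards [h1] with t ht using ht.deriv
  have h3 : HasDerivAt (fun t => φ' t - m / 2 * t) (m - m / 2 * 1) 0 :=
    hφ'.sub ((hasDerivAt_id 0).const_mul (m / 2))
  have h0 : φ' 0 = 0 := hmin.hasDerivAt_eq_zero hφ.self_of_nhds
  have hmax : IsLocalMax ψ 0 := by
    apply isLocalMax_of_deriv_deriv_neg
    · rw [h2.deriv_eq, h3.deriv]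
      linarith
    · simp [h2.self_of_nhds, h0]
    · exact h1.self_of_nhds.continuousAt
  have hev : ∀ᶠ t in 𝓝[≠] (0 : ℝ), False := by
    filter_upwards [nhdsWithin_le_nhds hmax, nhdsWithin_le_nhds hmin, self_mem_nhdsWithin]
      with t ht1 ht2 ht3
    have : 0 < t ^ 2 := by
      have : t ≠ 0 := ht3
      positivity
    simp only [hψ] at ht1
    nlinarith
  exact hev.exists.choose_spec

section Line

variable {E : Type*} [NormedAddCommGroup E] [NormedSpace ℝ E] {u : E → ℝ}

theorem hasDerivAt_add_smul (x v : E) (t : ℝ) : HasDerivAt (fun t : ℝ => x + t • v) v t := by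
  simpa using ((hasDerivAt_id t).smul_const v).const_add x

theorem hasDerivAt_comp_line (hu : Differentiable ℝ u) (x v : E) (t : ℝ) :
    HasDerivAt (fun t : ℝ => u (x + t • v)) (fderiv ℝ u (x + t • v) v) t :=
  (hu (x + t • v)).hasFDerivAt.comp_hasDerivAt t (hasDerivAt_add_smul x v t)

theorem hasDerivAt_fderiv_comp_line (hu' : Differentiable ℝ (fderiv ℝ u)) (x v : E) :
    HasDerivAt (fun t : ℝ => fderiv ℝ u (x + t • v) v) (fderiv ℝ (fderiv ℝ u) x v v) 0 := by
  have h := (hu' (x + (0 : ℝ) • v)).hasFDerivAt.comp_hasDerivAt (0 : ℝ)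
    (hasDerivAt_add_smul x v 0)
  simpa using h.clm_apply (hasDerivAt_const (0 : ℝ) v)

theorem fderiv_fderiv_nonneg_of_convexOn (hu : Differentiable ℝ u)
    (hu' : Differentiable ℝ (fderiv ℝ u)) (hc : ConvexOn ℝ univ u) (x v : E) :
    0 ≤ fderiv ℝ (fderiv ℝ u) x v v := by
  have hconv : ConvexOn ℝ univ (fun t : ℝ => u (x + t • v)) := by
    have := hc.comp_affineMap (AffineMap.lineMap x (x + v) : ℝ →ᵃ[ℝ] E)
    simpa [Function.comp_def, AffineMap.lineMap_apply, add_comm] using this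
  have hmono := hconv.monotoneOn_deriv
    fun t _ => (hasDerivAt_comp_line hu x v t).differentiableAt
  have heq : deriv (fun t : ℝ => u (x + t • v)) = fun t => fderiv ℝ u (x + t • v) v :=
    funext fun t => (hasDerivAt_comp_line hu x v t).deriv
  rw [heq, monotoneOn_univ] at hmono
  rw [← (hasDerivAt_fderiv_comp_line hu' x v).deriv]
  exact hmono.deriv_nonneg

/-- If a function of one variable touches `u` from above along a line, then its second derivative
at the contact point dominates that of `u` in the direction of the line. -/
theorem fderiv_fderiv_le_of_touching (hu : Differentiable ℝ u)
    (hu' : Differentiable ℝ (fderiv ℝ u)) (x v : E) {w w' : ℝ → ℝ} {m : ℝ}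
    (hw : ∀ᶠ t in 𝓝 0, HasDerivAt w (w' t) t) (hw' : HasDerivAt w' m 0)
    (hle : ∀ᶠ t in 𝓝 (0 : ℝ), u (x + t • v) ≤ w t) (heq : u x = w 0) :
    fderiv ℝ (fderiv ℝ u) x v v ≤ m := by
  have h := nonneg_of_isLocalMin_of_hasDerivAt
    (φ := fun t => w t - u (x + t • v)) (φ' := fun t => w' t - fderiv ℝ u (x + t • v) v)
    (hw.mono fun t ht => ht.sub (hasDerivAt_comp_line hu x v t))
    (hw'.sub (hasDerivAt_fderiv_comp_line hu' x v))
    (hle.mono fun t ht => by simpa [heq] using ht)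
  linarith

end Line

section Barrier

variable {E : Type*} [NormedAddCommGroup E] [InnerProductSpace ℝ E] {u : E → ℝ}

/-- The restriction of `x ↦ 1 - e * ‖x‖ ^ 2` to a line. -/
theorem hasDerivAt_one_sub_mul_norm_sq (e : ℝ) (x v : E) (t : ℝ) :
    HasDerivAt (fun t : ℝ => 1 - e * ‖x + t • v‖ ^ 2) (-(2 * e * inner ℝ (x + t • v) v)) t := by
  refine ((((hasDerivAt_add_smul x v t).norm_sq).const_mul e).const_sub 1).congr_deriv ?_
  ring

/-- If `k * (1 - e * ‖y‖ ^ 2) ^ (-N)` touches `u` from above at `x`, the second derivatives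
of `u` at `x` are bounded accordingly. -/
theorem fderiv_fderiv_le_of_barrier (hu : Differentiable ℝ u)
    (hu' : Differentiable ℝ (fderiv ℝ u)) {e k : ℝ} (he : 0 < e) (hk : 0 < k) (N : ℕ) {x : E}
    (hx : 0 < 1 - e * ‖x‖ ^ 2)
    (hle : ∀ y, 0 < 1 - e * ‖y‖ ^ 2 → u y ≤ k * (1 - e * ‖y‖ ^ 2) ^ (-(N : ℤ)))
    (heq : u x = k * (1 - e * ‖x‖ ^ 2) ^ (-(N : ℤ))) {v : E} (hv : ‖v‖ = 1) :
    fderiv ℝ (fderiv ℝ u) x v v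
      ≤ k * ((4 * N * (N + 1) + 2 * N) * e) * (1 - e * ‖x‖ ^ 2) ^ (-(N : ℤ) - 2) := by
  set s : ℝ → ℝ := fun t => 1 - e * ‖x + t • v‖ ^ 2 with hs
  have hs' := hasDerivAt_one_sub_mul_norm_sq e x v
  have hs0 : s 0 = 1 - e * ‖x‖ ^ 2 := by simp [hs]
  have hs0pos : 0 < s 0 := hs0 ▸ hx
  have hpos : ∀ᶠ t in 𝓝 0, 0 < s t :=
    continuousAt_const.eventually_lt (hs' 0).continuousAt hs0pos
  have hs'' : HasDerivAt (fun t : ℝ => -(2 * e * inner ℝ (x + t • v) v)) (-(2 * e)) 0 := by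
    have h := (((hasDerivAt_add_smul x v 0).inner ℝ (hasDerivAt_const (0 : ℝ) v)).const_mul
      (2 * e)).neg
    exact h.congr_deriv (by simp [hv])
  have hpow : ∀ (j : ℤ) (t : ℝ), 0 < s t → HasDerivAt (fun t => s t ^ j)
      (j * s t ^ (j - 1) * -(2 * e * inner ℝ (x + t • v) v)) t := fun j t ht =>
    (hasDerivAt_zpow j (s t) (Or.inl ht.ne')).comp t (hs' t)
  have key := fderiv_fderiv_le_of_touching hu hu' x v (w := fun t => k * s t ^ (-(N : ℤ)))
    (hpos.mono fun t ht => (hpow (-(N : ℤ)) t ht).const_mul k)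
    ((((hpow (-(N : ℤ) - 1) 0 hs0pos).const_mul ((-(N : ℤ) : ℤ) : ℝ)).mul hs'').const_mul k)
    (hpos.mono fun t ht => hle _ ht) (by simp only [hs0, heq])
  refine key.trans ?_
  rw [show -(N : ℤ) - 1 - 1 = -(N : ℤ) - 2 by ring, hs0]
  have hz : (1 - e * ‖x‖ ^ 2) ^ (-(N : ℤ) - 1)
      = (1 - e * ‖x‖ ^ 2) ^ (-(N : ℤ) - 2) * (1 - e * ‖x‖ ^ 2) := by
    rw [← zpow_add_one₀ hx.ne']
    congr 1
    ring
  rw [hz]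
  have hZ : 0 < (1 - e * ‖x‖ ^ 2) ^ (-(N : ℤ) - 2) := zpow_pos hx _
  set Z := (1 - e * ‖x‖ ^ 2) ^ (-(N : ℤ) - 2)
  have hb : (inner ℝ x v) ^ 2 ≤ ‖x‖ ^ 2 := by
    have := abs_real_inner_le_norm x v
    rw [hv, mul_one] at this
    exact sq_le_sq' (abs_le.1 this).1 (abs_le.1 this).2
  have hb' : e * (inner ℝ x v) ^ 2 ≤ 1 := by nlinarith
  have hsle : 1 - e * ‖x‖ ^ 2 ≤ 1 := by nlinarith [sq_nonneg ‖x‖]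
  simp only [zero_smul, add_zero]
  push_cast
  set b := inner ℝ x v
  set σ := 1 - e * ‖x‖ ^ 2
  -- The barrier's second derivative is `k Z (4N(N+1) e² b² + 2N e σ)`. `h1` and `h2` are the losses
  -- in replacing `e b²` and `σ` by 1.
  have h1 : 0 ≤ 4 * (N : ℝ) * (N + 1) * e * (1 - e * b ^ 2) := by
    have := sub_nonneg.2 hb'
    positivity
  have h2 : 0 ≤ 2 * (N : ℝ) * e * (1 - σ) := by
    have := sub_nonneg.2 hsle
    positivity
  have h3 := mul_nonneg (mul_pos hk hZ).le (add_nonneg h1 h2)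
  linear_combination h3

end Barrier

theorem Matrix.IsHermitian.det_le_pow_of_eigenvalues {n : ℕ} {M : Matrix (Fin n) (Fin n) ℝ}
    (hM : M.IsHermitian) {c : ℝ} (h0 : ∀ i, 0 ≤ hM.eigenvalues i)
    (hc : ∀ i, hM.eigenvalues i ≤ c) : M.det ≤ c ^ n := by
  rw [hM.det_eq_prod_eigenvalues]
  simpa using Finset.prod_le_prod (s := Finset.univ) (fun i _ => h0 i) fun i _ => hc i

theorem dotProduct_hessian_mulVec {n : ℕ} (u : EuclideanSpace ℝ (Fin n) → ℝ)
    (x v : EuclideanSpace ℝ (Fin n)) :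
    dotProduct (⇑v) ((hessian u x).mulVec ⇑v) = fderiv ℝ (fderiv ℝ u) x v v := by
  have hv : v = ∑ i, v i • EuclideanSpace.single i (1 : ℝ) := by
    ext j
    simp [Finset.sum_apply, Pi.single_apply]
  conv_rhs => rw [hv]
  simp only [map_sum, map_smul, sum_apply, smul_apply,
    dotProduct, Matrix.mulVec, hessian, Matrix.of_apply, smul_eq_mul, Finset.mul_sum]
  rw [Finset.sum_comm]
  refine Finset.sum_congr rfl fun i _ => Finset.sum_congr rfl fun j _ => ?_
  ring

theorem hessian_isHermitian {n : ℕ} {u : EuclideanSpace ℝ (Fin n) → ℝ}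
    (hu : Differentiable ℝ u) (hu' : Differentiable ℝ (fderiv ℝ u))
    (x : EuclideanSpace ℝ (Fin n)) : (hessian u x).IsHermitian := by
  ext i j
  simpa [hessian] using second_derivative_symmetric (fun y => (hu y).hasFDerivAt)
    (hu' x).hasFDerivAt (EuclideanSpace.single j 1) (EuclideanSpace.single i 1)

/-- Each eigenvalue is the second derivative along a unit eigenvector. Convexity makes it
nonnegative, without which upper bounds on the eigenvalues would not bound their product. -/
theorem det_hessian_le {n : ℕ} {u : EuclideanSpace ℝ (Fin n) → ℝ}
    (hu : Differentiable ℝ u) (hu' : Differentiable ℝ (fderiv ℝ u)) (hc : ConvexOn ℝ univ u)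
    (x : EuclideanSpace ℝ (Fin n)) {c : ℝ}
    (h : ∀ v, ‖v‖ = 1 → fderiv ℝ (fderiv ℝ u) x v v ≤ c) : (hessian u x).det ≤ c ^ n := by
  have hH := hessian_isHermitian hu hu' x
  have hev : ∀ i, hH.eigenvalues i
      = fderiv ℝ (fderiv ℝ u) x (hH.eigenvectorBasis i) (hH.eigenvectorBasis i) := fun i => by
    rw [hH.eigenvalues_eq, ← dotProduct_hessian_mulVec]
    simp
  refine hH.det_le_pow_of_eigenvalues (fun i => ?_) fun i => ?_
  · rw [hev]
    exact fderiv_fderiv_nonneg_of_convexOn hu hu' hc _ _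
  · rw [hev]
    exact h _ (hH.eigenvectorBasis.orthonormal.1 i)

/-- A positive continuous function on a proper space touches a multiple `k` of the barrier
`(1 - e * ‖y‖ ^ 2) ^ (-N)` from below inside the ball where the barrier is finite. -/
theorem exists_touching_barrier {E : Type*} [NormedAddCommGroup E] [ProperSpace E] {u : E → ℝ}
    (hu : Continuous u) (hpos : ∀ x, 0 < u x) {e : ℝ} (he : 0 < e) {N : ℕ} (hN : N ≠ 0) :
    ∃ k x, u 0 ≤ k ∧ 0 < 1 - e * ‖x‖ ^ 2 ∧
      (∀ y, 0 < 1 - e * ‖y‖ ^ 2 → u y ≤ k * (1 - e * ‖y‖ ^ 2) ^ (-(N : ℤ))) ∧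
      u x = k * (1 - e * ‖x‖ ^ 2) ^ (-(N : ℤ)) := by
  have hsub : {y : E | 0 ≤ 1 - e * ‖y‖ ^ 2} ⊆ Metric.closedBall 0 (√(1 / e)) := by
    intro y hy
    rw [mem_closedBall_zero_iff]
    apply Real.le_sqrt_of_sq_le
    rw [le_div_iff₀ he]
    have : 0 ≤ 1 - e * ‖y‖ ^ 2 := hy
    linarith
  have hK : IsCompact {y : E | 0 ≤ 1 - e * ‖y‖ ^ 2} :=
    (isCompact_closedBall 0 _).of_isClosed_subset
      (isClosed_le continuous_const (by fun_prop)) hsub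
  -- The maximum of `u / barrier` over the closed ball serves as `k`. The product vanishes on the
  -- sphere since `N ≠ 0` and equals `u 0 > 0` at the centre, so the maximum is interior.
  obtain ⟨x, hxK, hmax⟩ := hK.exists_isMaxOn ⟨0, by simp⟩
    (f := fun y => u y * (1 - e * ‖y‖ ^ 2) ^ N) (by fun_prop)
  have h0 : u 0 ≤ u x * (1 - e * ‖x‖ ^ 2) ^ N := by
    simpa using hmax (show (0 : E) ∈ {y : E | 0 ≤ 1 - e * ‖y‖ ^ 2} by simp)
  have hx : 0 < 1 - e * ‖x‖ ^ 2 := by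
    refine lt_of_le_of_ne hxK fun h => ?_
    rw [← h, zero_pow hN, mul_zero] at h0
    exact absurd (hpos 0) h0.not_gt
  refine ⟨_, x, h0, hx, fun y hy => ?_, ?_⟩
  · rw [zpow_neg, zpow_natCast, ← div_eq_mul_inv, le_div_iff₀ (pow_pos hy N)]
    exact hmax hy.le
  · rw [zpow_neg, zpow_natCast, mul_inv_cancel_right₀ (pow_pos hx N).ne']

/-- The scale-dependent bound on `u 0`; letting `e → 0` rules out entire solutions. -/
theorem mul_rpow_le_of_entire {n : ℕ} {u : EuclideanSpace ℝ (Fin n) → ℝ}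
    (hu : Differentiable ℝ u) (hu' : Differentiable ℝ (fderiv ℝ u)) (hc : ConvexOn ℝ univ u)
    (hpos : ∀ x, 0 < u x) {p A : ℝ} (hp : (n : ℝ) < p) (hA : 0 < A)
    (hdet : ∀ x, A * u x ^ p ≤ (hessian u x).det) {N : ℕ} (hN : N ≠ 0)
    (hNp : (N + 2) * (n : ℝ) ≤ N * p) {e : ℝ} (he : 0 < e) :
    A * u 0 ^ (p - n) ≤ ((4 * N * (N + 1) + 2 * N) * e) ^ n := by
  obtain ⟨k, x, hk0, hx, hle, heq⟩ := exists_touching_barrier hu.continuous hpos he hN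
  have hk : 0 < k := (hpos 0).trans_le hk0
  have hdet' := (hdet x).trans (det_hessian_le hu hu' hc x fun v hv =>
    fderiv_fderiv_le_of_barrier hu hu' he hk N hx hle heq hv)
  set s := 1 - e * ‖x‖ ^ 2
  set D := (4 * N * (N + 1) + 2 * N) * e
  have hs1 : s ≤ 1 := by
    have : 0 ≤ e * ‖x‖ ^ 2 := by positivity
    simp only [s]
    linarith
  have hzr : ∀ j : ℤ, s ^ j = s ^ (j : ℝ) := fun j => (Real.rpow_intCast s j).symm
  have hD : 0 ≤ D := by positivity
  rw [heq, hzr, hzr, Real.mul_rpow hk.le (Real.rpow_nonneg hx.le _), ← Real.rpow_mul hx.le,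
    mul_pow, mul_pow, ← Real.rpow_mul_natCast hx.le] at hdet'
  push_cast at hdet'
  -- For a base in `(0, 1]` the smaller exponent gives the larger power; `hNp` compares the
  -- exponents.
  have hsle : s ^ ((-(N : ℝ) - 2) * n) ≤ s ^ (-(N : ℝ) * p) :=
    Real.rpow_le_rpow_of_exponent_ge hx hs1 (by linarith)
  have hS : 0 < s ^ (-(N : ℝ) * p) := Real.rpow_pos_of_pos hx _
  have h1 : A * k ^ p * s ^ (-(N : ℝ) * p) ≤ k ^ n * D ^ n * s ^ (-(N : ℝ) * p) := by
    calc _ = A * (k ^ p * s ^ (-(N : ℝ) * p)) := by ring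
      _ ≤ _ := hdet'
      _ ≤ _ := by gcongr
  have h2 : A * k ^ p ≤ k ^ n * D ^ n := le_of_mul_le_mul_right h1 hS
  calc A * u 0 ^ (p - n) ≤ A * k ^ (p - n) := by
        gcongr
        exact (hpos 0).le
    _ = A * k ^ p / k ^ n := by rw [Real.rpow_sub hk, Real.rpow_natCast, mul_div_assoc]
    _ ≤ D ^ n := by
        rw [div_le_iff₀ (pow_pos hk n)]
        linarith

theorem theorem3p1 (n : ℕ) (hn : 1 ≤ n) (f : ℝ → ℝ)
    (hf_cont : ContinuousOn f (Set.Ioi 0))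
    (hf_pos : ∀ t : ℝ, 0 < t → 0 < f t)
    (hf_mono : MonotoneOn f (Set.Ioi 0))
    (p A : ℝ) (hp : (n : ℝ) < p) (hA : 0 < A)
    (hf_lower : ∀ t : ℝ, 0 < t → A * t ^ p ≤ f t) :
    ¬ ∃ u : EuclideanSpace ℝ (Fin n) → ℝ,
      (∀ x, 0 < u x) ∧ ConvexOn ℝ Set.univ u ∧ IsEntireSolution f u := by
  rintro ⟨u, hpos, hc, hu, hu', hdet⟩
  -- `N ≥ 2n / (p - n)` is equivalent to `(N + 2) n ≤ N p`.
  obtain ⟨N, hN⟩ := exists_nat_ge (2 * n / (p - n))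
  have hpn : 0 < p - n := sub_pos.2 hp
  rw [div_le_iff₀ hpn] at hN
  have hN0 : N ≠ 0 := by
    rintro rfl
    have : (1 : ℝ) ≤ n := by exact_mod_cast hn
    simp only [Nat.cast_zero, zero_mul] at hN
    linarith
  have hbound : ∀ e : ℝ, 0 < e →
      A * u 0 ^ (p - n) ≤ ((4 * N * (N + 1) + 2 * N) * e) ^ n := fun e he =>
    mul_rpow_le_of_entire hu hu' hc hpos hp hA
      (fun x => (hdet x).symm ▸ hf_lower _ (hpos x)) hN0 (by linarith) he
  have hlim : Tendsto (fun e : ℝ => ((4 * N * (N + 1) + 2 * N) * e) ^ n) (𝓝[>] 0) (𝓝 0) := by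
    have h : Continuous fun e : ℝ => ((4 * N * (N + 1) + 2 * N) * e) ^ n := by fun_prop
    have h0 := h.tendsto 0
    rw [mul_zero, zero_pow (by omega)] at h0
    exact h0.mono_left nhdsWithin_le_nhds
  have hle : A * u 0 ^ (p - n) ≤ 0 :=
    ge_of_tendsto hlim (eventually_nhdsWithin_of_forall fun e he => hbound e he)
  exact absurd (mul_pos hA (Real.rpow_pos_of_pos (hpos 0) _)) hle.not_gt
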